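/- Let $I\subseteq\mathbb R$ be a nonempty open interval and consider the equation $$u_t=a^2(t)\,u_{xx}+b(t)\,u-c(t)\,u^3,\qquad(\ast)$$ where $a,b,c\colon I\to\mathbb R$ are smooth and $a$ and $c$ vanish nowhere on $I$. Let $\Omega\subseteq I\times\mathbb R\times\mathbb R$ be an open set of points $(t,x,u)$ whose projection to the $t$-axis is all of $I$ (for instance $\Omega=I\times\mathbb R^2$). Say that $(\ast)$ is reduced over $\Omega$ to a constant-coefficient equation of the same class by a point transformation if there are constants $A\neq0$, $B$, $C\neq0$ and a smooth diffeomorphism $\Phi\colon(t,x,u)\mapsto(\tilde t,\tilde x,\tilde u)$ of $\Omega$ onto an open subset of $\mathbb R^3$ that maps $(\ast)$ to $$\tilde u_{\tilde t}=A^2\tilde u_{\tilde x\tilde x}+B\tilde u-C\tilde u^3,$$ that is, a 2-jet over $\Omega$ at which the second prolongation of $\Phi$ is defined satisfies $(\ast)$ if and only if its image under this prolongation satisfies the latter equation. Then $(\ast)$ is reduced over $\Omega$ to a constant-coefficient equation of the same class by a point transformation if and only if there is a constant $\lambda\in\mathbb R$ such that, for all $t\in I$, $$\frac{b}{a^2}+\frac12\,\frac{(c/a^2)_t}{c}=\lambda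 .$$ -/

import Mathlib

open scoped ContDiff

namespace NWS

/-- The space of independent and dependent variables: points `(t, x, u)`. -/
abbrev Jet0 : Type := ℝ × ℝ × ℝ

/-- The first-order jet space: points `((t, x, u), (u_t, u_x))`. -/
abbrev Jet1 : Type := Jet0 × (ℝ × ℝ)

/-- The second-order jet space of real functions `u = u(t, x)`. -/
@[ext] structure Jet2 where
  t : ℝ
  x : ℝ
  u : ℝ
  ut : ℝ
  ux : ℝ
  utt : ℝ
  utx : ℝ
  uxx : ℝ

/-- Projection `J² → J⁰`. -/
def Jet2.base (j : Jet2) : Jet0 := (j.t, j.x, j.u)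

/-- Projection `J² → J¹`. -/
def Jet2.toJet1 (j : Jet2) : Jet1 := ((j.t, j.x, j.u), (j.ut, j.ux))

/-- The equation `u_t = a(t)² u_xx + b(t) u - c(t) u³`, as a subset of the second-order
jet space. -/
def equation (a b c : ℝ → ℝ) : Set Jet2 :=
  {j | j.ut = a j.t ^ 2 * j.uxx + b j.t * j.u - c j.t * j.u ^ 3}

/-- The total derivative `D_t F = F_t + u_t F_u` of a function `F(t, x, u)`. -/
noncomputable def totalT0 (F : Jet0 → ℝ) (z : Jet1) : ℝ :=
  fderiv ℝ F z.1 (1, 0, z.2.1)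

/-- The total derivative `D_x F = F_x + u_x F_u` of a function `F(t, x, u)`. -/
noncomputable def totalX0 (F : Jet0 → ℝ) (z : Jet1) : ℝ :=
  fderiv ℝ F z.1 (0, 1, z.2.2)

/-- The total derivative `D_t G = G_t + u_t G_u + u_tt G_{u_t} + u_tx G_{u_x}` of a function
`G` on the first-order jet space. -/
noncomputable def totalT1 (G : Jet1 → ℝ) (j : Jet2) : ℝ :=
  fderiv ℝ G j.toJet1 ((1, 0, j.ut), (j.utt, j.utx))

/-- The total derivative `D_x G = G_x + u_x G_u + u_tx G_{u_t} + u_xx G_{u_x}` of a function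
`G` on the first-order jet space. -/
noncomputable def totalX1 (G : Jet1 → ℝ) (j : Jet2) : ℝ :=
  fderiv ℝ G j.toJet1 ((0, 1, j.ux), (j.utx, j.uxx))

/-- The component `T` of a transformation `t' = T(t, x, u)`, `x' = X(t, x, u)`, `u' = U(t, x, u)`. -/
def compT (Φ : Jet0 → Jet0) (p : Jet0) : ℝ := (Φ p).1

/-- The component `X` of a transformation. -/
def compX (Φ : Jet0 → Jet0) (p : Jet0) : ℝ := (Φ p).2.1

/-- The component `U` of a transformation. -/
def compU (Φ : Jet0 → Jet0) (p : Jet0) : ℝ := (Φ p).2.2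

/-- The total Jacobian `D_t T · D_x X - D_x T · D_t X`. It is nonzero exactly at the jets of those
functions `u(t, x)` whose graph is locally mapped to the graph of a function `u'(t', x')`. -/
noncomputable def totalJac (Φ : Jet0 → Jet0) (z : Jet1) : ℝ :=
  totalT0 (compT Φ) z * totalX0 (compX Φ) z - totalX0 (compT Φ) z * totalT0 (compX Φ) z

/-- The transformed first derivative `u'_{t'} = (D_x X · D_t U - D_t X · D_x U) / Jac`. -/
noncomputable def newUt (Φ : Jet0 → Jet0) (z : Jet1) : ℝ :=
  (totalX0 (compX Φ) z * totalT0 (compU Φ) z - totalT0 (compX Φ) z * totalX0 (compU Φ) z) /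
    totalJac Φ z

/-- The transformed first derivative `u'_{x'} = (D_t T · D_x U - D_x T · D_t U) / Jac`. -/
noncomputable def newUx (Φ : Jet0 → Jet0) (z : Jet1) : ℝ :=
  (totalT0 (compT Φ) z * totalX0 (compU Φ) z - totalX0 (compT Φ) z * totalT0 (compU Φ) z) /
    totalJac Φ z

/-- The total derivative along `t'` of a function `G` on the first-order jet space:
`(D_x X · D_t G - D_t X · D_x G) / Jac`. -/
noncomputable def newDt (Φ : Jet0 → Jet0) (G : Jet1 → ℝ) (j : Jet2) : ℝ :=
  (totalX0 (compX Φ) j.toJet1 * totalT1 G j - totalT0 (compX Φ) j.toJet1 * totalX1 G j) /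
    totalJac Φ j.toJet1

/-- The total derivative along `x'` of a function `G` on the first-order jet space:
`(D_t T · D_x G - D_x T · D_t G) / Jac`. -/
noncomputable def newDx (Φ : Jet0 → Jet0) (G : Jet1 → ℝ) (j : Jet2) : ℝ :=
  (totalT0 (compT Φ) j.toJet1 * totalX1 G j - totalX0 (compT Φ) j.toJet1 * totalT1 G j) /
    totalJac Φ j.toJet1

/-- The second prolongation of a transformation of the variables `(t, x, u)`: the 2-jet of `u` is
sent to the 2-jet of the transformed function `u'`. It is meaningful where `totalJac Φ ≠ 0`. -/
noncomputable def prolong (Φ : Jet0 → Jet0) (j : Jet2) : Jet2 where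
  t := compT Φ j.base
  x := compX Φ j.base
  u := compU Φ j.base
  ut := newUt Φ j.toJet1
  ux := newUx Φ j.toJet1
  utt := newDt Φ (newUt Φ) j
  utx := newDt Φ (newUx Φ) j
  uxx := newDx Φ (newUx Φ) j

/-- A (nondegenerate) point transformation with domain `Ω`: a smooth diffeomorphism of the open
set `Ω` of the space of variables `(t, x, u)` onto its (open) image. -/
structure IsPointTransformation (Φ : Jet0 → Jet0) (Ω : Set Jet0) : Prop where
  smooth : ContDiffOn ℝ ∞ Φ Ω
  injOn : Set.InjOn Φ Ω
  det_ne_zero : ∀ p ∈ Ω, (fderiv ℝ Φ p).det ≠ 0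

/-- `Φ` maps the second-order equation `E` over `Ω` to the equation `E'`: wherever the prolongation
of `Φ` is defined over `Ω`, a 2-jet lies in `E` if and only if its image lies in `E'`. -/
def MapsEquation (Φ : Jet0 → Jet0) (Ω : Set Jet0) (E E' : Set Jet2) : Prop :=
  ∀ j : Jet2, j.base ∈ Ω → totalJac Φ j.toJet1 ≠ 0 → (j ∈ E ↔ prolong Φ j ∈ E')

/-- The equation with coefficients `a, b, c`, considered over `Ω`, is mapped by some point
transformation with domain `Ω` to an equation of the same class with constant coefficients
`A, B, C`, where `A` and `C` are nonzero. -/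
def ReducibleToConstant (a b c : ℝ → ℝ) (Ω : Set Jet0) : Prop :=
  ∃ (Φ : Jet0 → Jet0) (A B C : ℝ), A ≠ 0 ∧ C ≠ 0 ∧ IsPointTransformation Φ Ω ∧
    MapsEquation Φ Ω (equation a b c) (equation (fun _ => A) (fun _ => B) (fun _ => C))

end NWS

namespace NWS

open Filter Topology


/-! Necessity. Write `Φ = (T, X, U)`. Only the implication from (∗) to its image is used, together
with the freedom to vary jet coordinates on (∗). Since (∗) leaves `u_tt` free, the image's
`u'_{x'x'}` must not depend on it, which forces `T_x = T_u = 0` (`pdx_compT_and_pdu_compT_eq_zero`).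
The transformed equation is then a polynomial identity in the jet coordinates
(`determining_identity`). Its `u_xx`-coefficient gives `X_u = 0` and `a² X_x² = A² T_t`. Its
`u_x`-coefficients and `u`-derivatives give `X_t = U_xu = 0`, `U = u U_u`, `c = C T_t U_u²` and
`U_tu + b U_u = B U_u T_t` (`necessary_conditions`). Hence `c / a² = (C / A²) X_x² U_u²`, and as
`X_xt = 0`, half its logarithmic derivative is `U_tu / U_u`. The expression in the criterion
therefore equals `(B / A²) X_x²`, which is locally constant in `t`, hence constant on the connected
set `I`.

Sufficiency. Take `t' = ∫ a²`, `x' = x`, `u' = √(|c| / a²) u`. This normalises the diffusion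
coefficient to `1` and the cubic coefficient to the sign of `c`; the criterion says exactly that the
linear coefficient becomes `λ` (`mapsEquation_scaling`, `reducible_of_const`). -/

/-! ### Partial derivatives on the space of variables -/

/-- The partial derivative `F_t`. -/
noncomputable def pdt (F : Jet0 → ℝ) (p : Jet0) : ℝ := fderiv ℝ F p (1, 0, 0)

/-- The partial derivative `F_x`. -/
noncomputable def pdx (F : Jet0 → ℝ) (p : Jet0) : ℝ := fderiv ℝ F p (0, 1, 0)

/-- The partial derivative `F_u`. -/
noncomputable def pdu (F : Jet0 → ℝ) (p : Jet0) : ℝ := fderiv ℝ F p (0, 0, 1)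

theorem fderiv_apply_eq (F : Jet0 → ℝ) (p : Jet0) (α β γ : ℝ) :
    fderiv ℝ F p (α, β, γ) = α * pdt F p + β * pdx F p + γ * pdu F p := by
  have h : ((α, β, γ) : Jet0) = α • (1, 0, 0) + β • (0, 1, 0) + γ • (0, 0, 1) := by
    simp
  rw [h, map_add, map_add, map_smul, map_smul, map_smul]
  rfl

theorem totalT0_eq (F : Jet0 → ℝ) (z : Jet1) :
    totalT0 F z = pdt F z.1 + z.2.1 * pdu F z.1 := by
  rw [totalT0, fderiv_apply_eq]; ring

theorem totalX0_eq (F : Jet0 → ℝ) (z : Jet1) :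
    totalX0 F z = pdx F z.1 + z.2.2 * pdu F z.1 := by
  rw [totalX0, fderiv_apply_eq]; ring

section Smooth

variable {Ω : Set Jet0} {F G : Jet0 → ℝ}

theorem contDiffOn_fderiv_apply (hΩ : IsOpen Ω) (hF : ContDiffOn ℝ ∞ F Ω) (v : Jet0) :
    ContDiffOn ℝ ∞ (fun p => fderiv ℝ F p v) Ω :=
  (hF.fderiv_of_isOpen hΩ (by simp)).clm_apply contDiffOn_const

theorem contDiffOn_pdt (hΩ : IsOpen Ω) (hF : ContDiffOn ℝ ∞ F Ω) : ContDiffOn ℝ ∞ (pdt F) Ω :=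
  contDiffOn_fderiv_apply hΩ hF _

theorem contDiffOn_pdx (hΩ : IsOpen Ω) (hF : ContDiffOn ℝ ∞ F Ω) : ContDiffOn ℝ ∞ (pdx F) Ω :=
  contDiffOn_fderiv_apply hΩ hF _

theorem contDiffOn_pdu (hΩ : IsOpen Ω) (hF : ContDiffOn ℝ ∞ F Ω) : ContDiffOn ℝ ∞ (pdu F) Ω :=
  contDiffOn_fderiv_apply hΩ hF _

theorem differentiableAt_of_contDiffOn (hΩ : IsOpen Ω) (hF : ContDiffOn ℝ ∞ F Ω) {p : Jet0} (hp : p ∈ Ω) :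
    DifferentiableAt ℝ F p :=
  (hF.contDiffAt (hΩ.mem_nhds hp)).differentiableAt (by simp)

theorem fderiv_fderiv_apply_comm (hΩ : IsOpen Ω) (hF : ContDiffOn ℝ ∞ F Ω) {p : Jet0} (hp : p ∈ Ω)
    (v w : Jet0) :
    fderiv ℝ (fun q => fderiv ℝ F q w) p v = fderiv ℝ (fun q => fderiv ℝ F q v) p w := by
  have hd : DifferentiableAt ℝ (fderiv ℝ F) p :=
    ((hF.fderiv_of_isOpen hΩ (m := ∞) (by simp)).contDiffAt (hΩ.mem_nhds hp)).differentiableAt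
      (by simp)
  have key : ∀ v w : Jet0, fderiv ℝ (fun q => fderiv ℝ F q w) p v
      = fderiv ℝ (fderiv ℝ F) p v w := by
    intro v w
    rw [fderiv_clm_apply hd (differentiableAt_const w)]
    simp
  rw [key, key]
  have hs : IsSymmSndFDerivAt ℝ F p :=
    (hF.contDiffAt (hΩ.mem_nhds hp)).isSymmSndFDerivAt
      (by simpa using WithTop.coe_le_coe.2 (le_top : (2 : ℕ∞) ≤ ⊤))
  exact hs.eq v w

theorem fderiv_eq_of_eqOn (hΩ : IsOpen Ω) (h : ∀ p ∈ Ω, F p = G p) {p : Jet0} (hp : p ∈ Ω) :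
    fderiv ℝ F p = fderiv ℝ G p :=
  Filter.EventuallyEq.fderiv_eq (Filter.eventually_of_mem (hΩ.mem_nhds hp) h)

theorem fderiv_eq_zero_of_eqOn (hΩ : IsOpen Ω) (h : ∀ p ∈ Ω, F p = 0) {p : Jet0} (hp : p ∈ Ω) :
    fderiv ℝ F p = 0 := by
  rw [fderiv_eq_of_eqOn hΩ (G := fun _ => 0) h hp]
  simp

theorem hasDerivAt_t (hΩ : IsOpen Ω) (hF : ContDiffOn ℝ ∞ F Ω) {t x u : ℝ} (hp : ((t, x, u) : Jet0) ∈ Ω) :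
    HasDerivAt (fun s => F (s, x, u)) (pdt F (t, x, u)) t := by
  have h1 : HasDerivAt (fun s : ℝ => ((s, x, u) : Jet0)) (1, 0, 0) t :=
    (hasDerivAt_id t).prodMk ((hasDerivAt_const t x).prodMk (hasDerivAt_const t u))
  exact (differentiableAt_of_contDiffOn hΩ hF hp).hasFDerivAt.comp_hasDerivAt t h1

theorem hasDerivAt_x (hΩ : IsOpen Ω) (hF : ContDiffOn ℝ ∞ F Ω) {t x u : ℝ} (hp : ((t, x, u) : Jet0) ∈ Ω) :
    HasDerivAt (fun s => F (t, s, u)) (pdx F (t, x, u)) x := by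
  have h1 : HasDerivAt (fun s : ℝ => ((t, s, u) : Jet0)) (0, 1, 0) x :=
    (hasDerivAt_const x t).prodMk ((hasDerivAt_id x).prodMk (hasDerivAt_const x u))
  exact (differentiableAt_of_contDiffOn hΩ hF hp).hasFDerivAt.comp_hasDerivAt x h1

theorem hasDerivAt_u (hΩ : IsOpen Ω) (hF : ContDiffOn ℝ ∞ F Ω) {t x u : ℝ} (hp : ((t, x, u) : Jet0) ∈ Ω) :
    HasDerivAt (fun s => F (t, x, s)) (pdu F (t, x, u)) u := by
  have h1 : HasDerivAt (fun s : ℝ => ((t, x, s) : Jet0)) (0, 0, 1) u :=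
    (hasDerivAt_const u t).prodMk ((hasDerivAt_const u x).prodMk (hasDerivAt_id u))
  exact (differentiableAt_of_contDiffOn hΩ hF hp).hasFDerivAt.comp_hasDerivAt u h1

end Smooth


/-! ### Directional derivatives on the first-order jet space -/

section FirstOrder

variable {Ω : Set Jet0} {F : Jet0 → ℝ}

theorem hasFDerivAt_comp_fst (hΩ : IsOpen Ω) (hF : ContDiffOn ℝ ∞ F Ω) {z : Jet1}
    (hz : z.1 ∈ Ω) :
    HasFDerivAt (fun y : Jet1 => F y.1)
      ((fderiv ℝ F z.1).comp (ContinuousLinearMap.fst ℝ Jet0 (ℝ × ℝ))) z :=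
  (differentiableAt_of_contDiffOn hΩ hF hz).hasFDerivAt.comp z hasFDerivAt_fst

/-- The derivative is specified only by its values on vectors, which is all that the later quotient
computations evaluate. -/
theorem hasFDerivAt_totalT0 (hΩ : IsOpen Ω) (hF : ContDiffOn ℝ ∞ F Ω) {z : Jet1}
    (hz : z.1 ∈ Ω) :
    ∃ L : Jet1 →L[ℝ] ℝ, HasFDerivAt (totalT0 F) L z ∧ ∀ v α β,
      L (v, (α, β)) = fderiv ℝ (pdt F) z.1 v + z.2.1 * fderiv ℝ (pdu F) z.1 v
        + α * pdu F z.1 := by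
  have h1 := hasFDerivAt_comp_fst hΩ (contDiffOn_pdt hΩ hF) hz
  have h2 := hasFDerivAt_comp_fst hΩ (contDiffOn_pdu hΩ hF) hz
  have h3 : HasFDerivAt (fun y : Jet1 => y.2.1)
      ((ContinuousLinearMap.fst ℝ ℝ ℝ).comp (ContinuousLinearMap.snd ℝ Jet0 (ℝ × ℝ))) z :=
    ContinuousLinearMap.hasFDerivAt
      ((ContinuousLinearMap.fst ℝ ℝ ℝ).comp (ContinuousLinearMap.snd ℝ Jet0 (ℝ × ℝ)))
  have h4 := h1.fun_add (h3.fun_mul h2)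
  refine ⟨_, h4.congr_of_eventuallyEq (Eventually.of_forall fun y => totalT0_eq F y), ?_⟩
  intro v α β
  simp
  ring

theorem hasFDerivAt_totalX0 (hΩ : IsOpen Ω) (hF : ContDiffOn ℝ ∞ F Ω) {z : Jet1}
    (hz : z.1 ∈ Ω) :
    ∃ L : Jet1 →L[ℝ] ℝ, HasFDerivAt (totalX0 F) L z ∧ ∀ v α β,
      L (v, (α, β)) = fderiv ℝ (pdx F) z.1 v + z.2.2 * fderiv ℝ (pdu F) z.1 v
        + β * pdu F z.1 := by
  have h1 := hasFDerivAt_comp_fst hΩ (contDiffOn_pdx hΩ hF) hz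
  have h2 := hasFDerivAt_comp_fst hΩ (contDiffOn_pdu hΩ hF) hz
  have h3 : HasFDerivAt (fun y : Jet1 => y.2.2)
      ((ContinuousLinearMap.snd ℝ ℝ ℝ).comp (ContinuousLinearMap.snd ℝ Jet0 (ℝ × ℝ))) z :=
    ContinuousLinearMap.hasFDerivAt
      ((ContinuousLinearMap.snd ℝ ℝ ℝ).comp (ContinuousLinearMap.snd ℝ Jet0 (ℝ × ℝ)))
  have h4 := h1.fun_add (h3.fun_mul h2)
  refine ⟨_, h4.congr_of_eventuallyEq (Eventually.of_forall fun y => totalX0_eq F y), ?_⟩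
  intro v α β
  simp
  ring

end FirstOrder

theorem fderiv_div_apply {n m : Jet1 → ℝ} {z : Jet1} {n' m' : Jet1 →L[ℝ] ℝ}
    (hn : HasFDerivAt n n' z) (hm : HasFDerivAt m m' z) (h0 : m z ≠ 0) (v : Jet1) :
    fderiv ℝ (fun y => n y / m y) z v = (n' v * m z - n z * m' v) / m z ^ 2 := by
  have hd : DifferentiableAt ℝ (fun y => n y / m y) z := by
    simp only [div_eq_mul_inv]
    exact hn.differentiableAt.fun_mul (hm.differentiableAt.fun_inv h0)
  -- Differentiating `n = (n / m) m` by the product rule and solving for the derivative of the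
  -- quotient.
  have hev : ∀ᶠ y in 𝓝 z, n y = (n y / m y) * m y := by
    filter_upwards [hm.continuousAt.eventually_ne h0] with y hy
    field_simp
  have h1 := (hd.hasFDerivAt.fun_mul hm).congr_of_eventuallyEq hev
  have h2 := congrArg (fun L : Jet1 →L[ℝ] ℝ => L v) (hn.unique h1)
  simp only [add_apply, smul_apply, smul_eq_mul] at h2
  rw [h2]
  field_simp
  ring

/-! ### Components of a point transformation -/

section Components

variable {Ω : Set Jet0} {Φ : Jet0 → Jet0}

theorem IsPointTransformation.contDiffOn_compT (h : IsPointTransformation Φ Ω) :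
    ContDiffOn ℝ ∞ (compT Φ) Ω := h.smooth.fst

theorem IsPointTransformation.contDiffOn_compX (h : IsPointTransformation Φ Ω) :
    ContDiffOn ℝ ∞ (compX Φ) Ω := h.smooth.snd.fst

theorem IsPointTransformation.contDiffOn_compU (h : IsPointTransformation Φ Ω) :
    ContDiffOn ℝ ∞ (compU Φ) Ω := h.smooth.snd.snd

/-- The Jacobian determinant in terms of the partial derivatives of the components. -/
noncomputable def jacDet (Φ : Jet0 → Jet0) (p : Jet0) : ℝ :=
  pdt (compT Φ) p * (pdx (compX Φ) p * pdu (compU Φ) p - pdu (compX Φ) p * pdx (compU Φ) p)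
  - pdx (compT Φ) p * (pdt (compX Φ) p * pdu (compU Φ) p - pdu (compX Φ) p * pdt (compU Φ) p)
  + pdu (compT Φ) p * (pdt (compX Φ) p * pdx (compU Φ) p - pdx (compX Φ) p * pdt (compU Φ) p)

theorem fderiv_apply_components {p : Jet0} (hd : DifferentiableAt ℝ Φ p) (v : Jet0) :
    fderiv ℝ Φ p v =
      (fderiv ℝ (compT Φ) p v, fderiv ℝ (compX Φ) p v, fderiv ℝ (compU Φ) p v) := by
  have h := hd.hasFDerivAt
  have h1 : HasFDerivAt (compT Φ) _ p := h.fst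
  have h2 : HasFDerivAt (compX Φ) _ p := h.snd.fst
  have h3 : HasFDerivAt (compU Φ) _ p := h.snd.snd
  rw [h1.fderiv, h2.fderiv, h3.fderiv]
  rfl

/-- Both determinants vanish exactly when there is a nonzero kernel vector, and the two kernels
correspond coordinatewise; no matrix of the derivative in a basis is needed. -/
theorem det_fderiv_ne_zero_iff {p : Jet0} (hd : DifferentiableAt ℝ Φ p) :
    (fderiv ℝ Φ p).det ≠ 0 ↔ jacDet Φ p ≠ 0 := by
  set M : Matrix (Fin 3) (Fin 3) ℝ :=
    !![pdt (compT Φ) p, pdx (compT Φ) p, pdu (compT Φ) p;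
       pdt (compX Φ) p, pdx (compX Φ) p, pdu (compX Φ) p;
       pdt (compU Φ) p, pdx (compU Φ) p, pdu (compU Φ) p] with hM
  have hdet : M.det = jacDet Φ p := by
    rw [hM, Matrix.det_fin_three, jacDet]
    simp
    ring
  rw [← hdet, not_iff_not, ← Matrix.exists_mulVec_eq_zero_iff]
  have hker : (fderiv ℝ Φ p).det = 0 ↔ ∃ v : Jet0, v ≠ 0 ∧ fderiv ℝ Φ p v = 0 := by
    rw [ContinuousLinearMap.det, LinearMap.det_eq_zero_iff_ker_ne_bot, Submodule.ne_bot_iff]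
    constructor
    · rintro ⟨v, hv, h0⟩
      exact ⟨v, h0, hv⟩
    · rintro ⟨v, hv, h0⟩
      exact ⟨v, h0, hv⟩
  rw [hker]
  have hv : ∀ α β γ : ℝ, fderiv ℝ Φ p (α, β, γ) = 0 ↔ M.mulVec ![α, β, γ] = 0 := by
    intro α β γ
    rw [fderiv_apply_components hd, fderiv_apply_eq, fderiv_apply_eq, fderiv_apply_eq, hM]
    constructor
    · intro h
      simp only [Prod.mk_eq_zero] at h
      ext i
      fin_cases i
      · simp [Matrix.mulVec, dotProduct, Fin.sum_univ_three]; linarith [h.1]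
      · simp [Matrix.mulVec, dotProduct, Fin.sum_univ_three]; linarith [h.2.1]
      · simp [Matrix.mulVec, dotProduct, Fin.sum_univ_three]; linarith [h.2.2]
    · intro h
      have e0 := congrFun h 0
      have e1 := congrFun h 1
      have e2 := congrFun h 2
      simp [Matrix.mulVec, dotProduct, Fin.sum_univ_three] at e0 e1 e2
      simp only [Prod.mk_eq_zero]
      exact ⟨by linarith, by linarith, by linarith⟩
  constructor
  · rintro ⟨⟨α, β, γ⟩, h0, h⟩
    refine ⟨![α, β, γ], ?_, (hv _ _ _).1 h⟩
    intro h'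
    apply h0
    have e0 := congrFun h' 0
    have e1 := congrFun h' 1
    have e2 := congrFun h' 2
    simp at e0 e1 e2
    simp [e0, e1, e2]
  · rintro ⟨w, h0, h⟩
    have hw : w = ![w 0, w 1, w 2] := by
      ext i; fin_cases i <;> rfl
    refine ⟨(w 0, w 1, w 2), ?_, (hv _ _ _).2 (hw ▸ h)⟩
    intro h'
    apply h0
    simp only [Prod.mk_eq_zero] at h'
    rw [hw, h'.1, h'.2.1, h'.2.2]
    ext i; fin_cases i <;> rfl

end Components


/-! ### Second-order derivatives of the transformed function -/

section SecondOrder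

variable {Ω : Set Jet0} {F : Jet0 → ℝ}

theorem pdx_pdu_comm (hΩ : IsOpen Ω) (hF : ContDiffOn ℝ ∞ F Ω) {p : Jet0} (hp : p ∈ Ω) :
    pdx (pdu F) p = pdu (pdx F) p := fderiv_fderiv_apply_comm hΩ hF hp _ _

theorem pdt_pdu_comm (hΩ : IsOpen Ω) (hF : ContDiffOn ℝ ∞ F Ω) {p : Jet0} (hp : p ∈ Ω) :
    pdt (pdu F) p = pdu (pdt F) p := fderiv_fderiv_apply_comm hΩ hF hp _ _

theorem pdt_pdx_comm (hΩ : IsOpen Ω) (hF : ContDiffOn ℝ ∞ F Ω) {p : Jet0} (hp : p ∈ Ω) :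
    pdt (pdx F) p = pdx (pdt F) p := fderiv_fderiv_apply_comm hΩ hF hp _ _

/-- The iterated total derivative `D_x² F` of a function `F(t, x, u)`. -/
noncomputable def totalXX (F : Jet0 → ℝ) (j : Jet2) : ℝ :=
  pdx (pdx F) j.base + 2 * j.ux * pdu (pdx F) j.base + j.ux ^ 2 * pdu (pdu F) j.base
    + j.uxx * pdu F j.base

theorem totalX0_toJet1 (F : Jet0 → ℝ) (j : Jet2) :
    totalX0 F j.toJet1 = pdx F j.base + j.ux * pdu F j.base := totalX0_eq F j.toJet1

theorem totalT0_toJet1 (F : Jet0 → ℝ) (j : Jet2) :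
    totalT0 F j.toJet1 = pdt F j.base + j.ut * pdu F j.base := totalT0_eq F j.toJet1

end SecondOrder

/-! ### Prolonged derivatives and the vanishing of `T_x` and `T_u` -/

section Transformation

variable {Ω : Set Jet0} {Φ : Jet0 → Jet0}

/-- This is the only way `u_tt` enters `u'_{x'x'}`: it multiplies this derivative, with the further
factor `-D_x T / Jac`. The numerator of the quotient rule collapses to the full Jacobian
determinant, which is nonzero for a point transformation. -/
theorem fderiv_newUx_ut (hΩ : IsOpen Ω) (h : IsPointTransformation Φ Ω) {z : Jet1}
    (hz : z.1 ∈ Ω) (hJ : totalJac Φ z ≠ 0) :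
    fderiv ℝ (newUx Φ) z (0, (1, 0)) =
      -(totalX0 (compT Φ) z * jacDet Φ z.1) / totalJac Φ z ^ 2 := by
  obtain ⟨L1, h1, e1⟩ := hasFDerivAt_totalT0 hΩ h.contDiffOn_compT hz
  obtain ⟨L2, h2, e2⟩ := hasFDerivAt_totalX0 hΩ h.contDiffOn_compT hz
  obtain ⟨L3, h3, e3⟩ := hasFDerivAt_totalT0 hΩ h.contDiffOn_compX hz
  obtain ⟨L4, h4, e4⟩ := hasFDerivAt_totalX0 hΩ h.contDiffOn_compX hz
  obtain ⟨L5, h5, e5⟩ := hasFDerivAt_totalT0 hΩ h.contDiffOn_compU hz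
  obtain ⟨L6, h6, e6⟩ := hasFDerivAt_totalX0 hΩ h.contDiffOn_compU hz
  have hn := (h1.fun_mul h6).fun_sub (h2.fun_mul h5)
  have hm := (h1.fun_mul h4).fun_sub (h2.fun_mul h3)
  have key := fderiv_div_apply hn hm hJ (0, (1, 0))
  have : newUx Φ = fun y => (totalT0 (compT Φ) y * totalX0 (compU Φ) y -
    totalX0 (compT Φ) y * totalT0 (compU Φ) y) / (totalT0 (compT Φ) y * totalX0 (compX Φ) y -
    totalX0 (compT Φ) y * totalT0 (compX Φ) y) := rfl
  rw [this, key, totalJac]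
  congr 1
  simp only [sub_apply, add_apply, smul_apply, smul_eq_mul, e1, e2, e3, e4, e5, e6, map_zero,
    totalX0_eq, totalT0_eq, jacDet]
  ring

/-- The coefficient of `u_tt` in `u'_{x'x'}` is `(D_x T)² jacDet / Jac³`, and it must vanish on (∗).
So `Jac · D_x T = 0` for all `u_t, u_x`; as `Jac` is not identically zero in these variables, `D_x
T` is. -/
theorem pdx_compT_and_pdu_compT_eq_zero (hΩ : IsOpen Ω) (h : IsPointTransformation Φ Ω)
    {a b c : ℝ → ℝ} {A B C : ℝ} (hA : A ≠ 0) (ha : ∀ p ∈ Ω, a p.1 ≠ 0)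
    (hE : MapsEquation Φ Ω (equation a b c) (equation (fun _ => A) (fun _ => B) (fun _ => C)))
    {p : Jet0} (hp : p ∈ Ω) : pdx (compT Φ) p = 0 ∧ pdu (compT Φ) p = 0 := by
  obtain ⟨t, x, u⟩ := p
  have hdet : jacDet Φ (t, x, u) ≠ 0 :=
    (det_fderiv_ne_zero_iff ((h.smooth.contDiffAt (hΩ.mem_nhds hp)).differentiableAt (by simp))).1
      (h.det_ne_zero _ hp)
  have key : ∀ ut ux : ℝ, totalJac Φ ((t, x, u), (ut, ux)) *
      totalX0 (compT Φ) ((t, x, u), (ut, ux)) = 0 := by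
    intro ut ux
    by_contra hne
    have hJ := left_ne_zero_of_mul hne
    have hX := right_ne_zero_of_mul hne
    -- The value of `u_xx` that puts the jet on (∗) for the prescribed `u_t`, whatever `u_tt` is.
    set w := (ut - b t * u + c t * u ^ 3) / a t ^ 2 with hw
    have hat := ha _ hp
    have hut : ut = a t ^ 2 * w + b t * u - c t * u ^ 3 := by
      rw [hw]; simp only at hat; field_simp; ring
    have h0 : prolong Φ ⟨t, x, u, ut, ux, 0, 0, w⟩ ∈ equation _ _ _ :=
      (hE ⟨t, x, u, ut, ux, 0, 0, w⟩ hp hJ).1 hut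
    have h1 : prolong Φ ⟨t, x, u, ut, ux, 1, 0, w⟩ ∈ equation _ _ _ :=
      (hE ⟨t, x, u, ut, ux, 1, 0, w⟩ hp hJ).1 hut
    simp only [equation, Set.mem_ofPred_eq, prolong, Jet2.base, Jet2.toJet1] at h0 h1
    have h2 : newDx Φ (newUx Φ) ⟨t, x, u, ut, ux, 0, 0, w⟩ =
        newDx Φ (newUx Φ) ⟨t, x, u, ut, ux, 1, 0, w⟩ := by
      apply mul_left_cancel₀ (pow_ne_zero 2 hA)
      linarith
    simp only [newDx, totalT1, totalX1, Jet2.toJet1] at h2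
    have hsplit : (((1, 0, ut), (1, 0)) : Jet1) = ((1, 0, ut), (0, 0)) + (0, (1, 0)) := by simp
    rw [hsplit, map_add, fderiv_newUx_ut hΩ h hp hJ, div_left_inj' hJ] at h2
    have h3 : totalX0 (compT Φ) ((t, x, u), (ut, ux)) *
      (-(totalX0 (compT Φ) ((t, x, u), (ut, ux)) * jacDet Φ (t, x, u)) /
        totalJac Φ ((t, x, u), (ut, ux)) ^ 2) = 0 := by linarith
    simp [hX, hJ, hdet] at h3
  simp only [totalJac, totalX0_eq, totalT0_eq] at key
  set Tt := pdt (compT Φ) (t, x, u)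
  set Tx := pdx (compT Φ) (t, x, u)
  set Tu := pdu (compT Φ) (t, x, u)
  set Xt := pdt (compX Φ) (t, x, u)
  set Xx := pdx (compX Φ) (t, x, u)
  set Xu := pdu (compX Φ) (t, x, u)
  -- The total Jacobian is affine in `r = u_t` and `s = u_x`, with the 2×2 minors of `(T, X)` as
  -- coefficients. Five evaluations isolate the coefficients of the product.
  have hpoly : ∀ r s : ℝ, ((Tt * Xx - Tx * Xt) + r * (Tu * Xx - Tx * Xu)
      + s * (Tt * Xu - Tu * Xt)) * (Tx + s * Tu) = 0 := by
    intro r s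
    rw [← key r s]; ring
  have q00 := hpoly 0 0
  have q10 := hpoly 1 0
  have q01 := hpoly 0 1
  have q0n := hpoly 0 (-1)
  have q11 := hpoly 1 1
  have e1 : (Tu * Xx - Tx * Xu) * Tx = 0 := by linear_combination q10 - q00
  have e2 : (Tu * Xx - Tx * Xu) * Tu = 0 := by linear_combination q11 - q01 - q10 + q00
  have e3 : (Tt * Xx - Tx * Xt) * Tx = 0 := by linear_combination q00
  have e4 : (Tt * Xu - Tu * Xt) * Tx + (Tt * Xx - Tx * Xt) * Tu = 0 := by
    linear_combination (q01 - q0n) / 2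
  have e5 : (Tt * Xu - Tu * Xt) * Tu = 0 := by linear_combination (q01 + q0n) / 2 - q00
  by_cases k1 : Tu * Xx - Tx * Xu = 0
  · by_cases k2 : Tt * Xu - Tu * Xt = 0
    · by_cases k0 : Tt * Xx - Tx * Xt = 0
      -- If all three minors vanish, expanding the Jacobian determinant along the row of `U` gives
      -- zero.
      · exfalso
        apply hdet
        simp only [jacDet]
        linear_combination pdu (compU Φ) (t, x, u) * k0 - pdx (compU Φ) (t, x, u) * k2
          - pdt (compU Φ) (t, x, u) * k1
      · rw [k2] at e4
        simp_all
    · have hTu : Tu = 0 := by simpa [k2] using e5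
      rw [hTu] at e4
      simp_all
  · exact ⟨by simpa [k1] using e1, by simpa [k1] using e2⟩

theorem jacDet_of_pd_compT_eq_zero {p : Jet0} (hx : pdx (compT Φ) p = 0)
    (hu : pdu (compT Φ) p = 0) :
    jacDet Φ p = pdt (compT Φ) p * (pdx (compX Φ) p * pdu (compU Φ) p
      - pdu (compX Φ) p * pdx (compU Φ) p) := by
  rw [jacDet, hx, hu]; ring

theorem totalJac_of_pd_compT_eq_zero {z : Jet1} (hx : pdx (compT Φ) z.1 = 0)
    (hu : pdu (compT Φ) z.1 = 0) :
    totalJac Φ z = pdt (compT Φ) z.1 * totalX0 (compX Φ) z := by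
  simp only [totalJac, totalX0_eq, totalT0_eq, hx, hu]; ring

theorem newUt_of_pd_compT_eq_zero {z : Jet1} (hx : pdx (compT Φ) z.1 = 0)
    (hu : pdu (compT Φ) z.1 = 0) :
    newUt Φ z = (totalX0 (compX Φ) z * totalT0 (compU Φ) z -
      totalT0 (compX Φ) z * totalX0 (compU Φ) z) / (pdt (compT Φ) z.1 * totalX0 (compX Φ) z) := by
  rw [newUt, totalJac_of_pd_compT_eq_zero hx hu]

theorem newUx_of_pd_compT_eq_zero {z : Jet1} (hx : pdx (compT Φ) z.1 = 0)
    (hu : pdu (compT Φ) z.1 = 0) (hJ : totalJac Φ z ≠ 0) :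
    newUx Φ z = totalX0 (compU Φ) z / totalX0 (compX Φ) z := by
  have hT := totalT0_eq (compT Φ) z
  have hX := totalX0_eq (compT Φ) z
  rw [totalJac_of_pd_compT_eq_zero hx hu] at hJ
  have h1 := left_ne_zero_of_mul hJ
  have h2 := right_ne_zero_of_mul hJ
  rw [newUx, totalJac_of_pd_compT_eq_zero hx hu, hT, hX, hx, hu]
  field_simp
  ring

theorem totalX1_totalX0 {F : Jet0 → ℝ} (hΩ : IsOpen Ω) (hF : ContDiffOn ℝ ∞ F Ω) {j : Jet2}
    (hj : j.base ∈ Ω) {L : Jet1 →L[ℝ] ℝ}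
    (hL : ∀ v α β, L (v, (α, β)) = fderiv ℝ (pdx F) j.base v
      + j.ux * fderiv ℝ (pdu F) j.base v + β * pdu F j.base) :
    L ((0, 1, j.ux), (j.utx, j.uxx)) = totalXX F j := by
  rw [hL, fderiv_apply_eq, fderiv_apply_eq, pdx_pdu_comm hΩ hF hj, totalXX]
  ring

/-- With `D_x T = 0` the operator `D_{x'}` is `D_x / D_x X`, so the quotient rule suffices. The
formula `D_x U / D_x X` for `newUx` needs `Jac ≠ 0`, an open condition, hence holds near the jet and
may be differentiated. -/
theorem newDx_newUx (hΩ : IsOpen Ω) (h : IsPointTransformation Φ Ω)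
    (hx : ∀ p ∈ Ω, pdx (compT Φ) p = 0) (hu : ∀ p ∈ Ω, pdu (compT Φ) p = 0) {j : Jet2}
    (hj : j.base ∈ Ω) (hJ : totalJac Φ j.toJet1 ≠ 0) :
    newDx Φ (newUx Φ) j = (totalXX (compU Φ) j * totalX0 (compX Φ) j.toJet1
      - totalX0 (compU Φ) j.toJet1 * totalXX (compX Φ) j) / totalX0 (compX Φ) j.toJet1 ^ 3 := by
  have hz : j.toJet1.1 ∈ Ω := hj
  obtain ⟨L1, h1, e1⟩ := hasFDerivAt_totalT0 hΩ h.contDiffOn_compT hz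
  obtain ⟨L2, h2, e2⟩ := hasFDerivAt_totalX0 hΩ h.contDiffOn_compT hz
  obtain ⟨L3, h3, e3⟩ := hasFDerivAt_totalT0 hΩ h.contDiffOn_compX hz
  obtain ⟨L4, h4, e4⟩ := hasFDerivAt_totalX0 hΩ h.contDiffOn_compX hz
  obtain ⟨L6, h6, e6⟩ := hasFDerivAt_totalX0 hΩ h.contDiffOn_compU hz
  have hJ' := hJ
  rw [totalJac_of_pd_compT_eq_zero (hx _ hz) (hu _ hz)] at hJ'
  have hT0 := left_ne_zero_of_mul hJ'
  have hX0 := right_ne_zero_of_mul hJ'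
  have hcont : ContinuousAt (totalJac Φ) j.toJet1 :=
    ((h1.fun_mul h4).fun_sub (h2.fun_mul h3)).continuousAt
  have hev : newUx Φ =ᶠ[𝓝 j.toJet1] fun y => totalX0 (compU Φ) y / totalX0 (compX Φ) y := by
    filter_upwards [hcont.eventually_ne hJ,
      (continuous_fst.continuousAt (x := j.toJet1)).preimage_mem_nhds (hΩ.mem_nhds hz)] with y hy hy1
    exact newUx_of_pd_compT_eq_zero (hx _ hy1) (hu _ hy1) hy
  have hd : totalX1 (newUx Φ) j = (totalXX (compU Φ) j * totalX0 (compX Φ) j.toJet1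
      - totalX0 (compU Φ) j.toJet1 * totalXX (compX Φ) j) / totalX0 (compX Φ) j.toJet1 ^ 2 := by
    rw [totalX1, hev.fderiv_eq, fderiv_div_apply h6 h4 hX0,
      totalX1_totalX0 hΩ h.contDiffOn_compU hj e6, totalX1_totalX0 hΩ h.contDiffOn_compX hj e4]
  have hT := totalT0_eq (compT Φ) j.toJet1
  have hX := totalX0_eq (compT Φ) j.toJet1
  rw [hx _ hz, hu _ hz] at hX
  rw [hu _ hz] at hT
  rw [newDx, hd, totalJac_of_pd_compT_eq_zero (hx _ hz) (hu _ hz), hT, hX]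
  field_simp
  ring

end Transformation


/-! ### Differentiating identities along coordinate lines in `Ω` -/

section Calculus

variable {Ω : Set Jet0}

theorem eventually_mem_t (hΩ : IsOpen Ω) {t x u : ℝ} (hp : ((t, x, u) : Jet0) ∈ Ω) :
    ∀ᶠ s in 𝓝 t, ((s, x, u) : Jet0) ∈ Ω :=
  (Continuous.continuousAt (by fun_prop : Continuous fun s : ℝ => ((s, x, u) : Jet0))
    (x := t)).eventually (hΩ.mem_nhds hp)

theorem eventually_mem_x (hΩ : IsOpen Ω) {t x u : ℝ} (hp : ((t, x, u) : Jet0) ∈ Ω) :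
    ∀ᶠ s in 𝓝 x, ((t, s, u) : Jet0) ∈ Ω :=
  (Continuous.continuousAt (by fun_prop : Continuous fun s : ℝ => ((t, s, u) : Jet0))
    (x := x)).eventually (hΩ.mem_nhds hp)

theorem eventually_mem_u (hΩ : IsOpen Ω) {t x u : ℝ} (hp : ((t, x, u) : Jet0) ∈ Ω) :
    ∀ᶠ s in 𝓝 u, ((t, x, s) : Jet0) ∈ Ω :=
  (Continuous.continuousAt (by fun_prop : Continuous fun s : ℝ => ((t, x, s) : Jet0))
    (x := u)).eventually (hΩ.mem_nhds hp)

theorem eq_of_eventually_eq_of_hasDerivAt {f g : ℝ → ℝ} {f' g' s : ℝ}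
    (h : ∀ᶠ r in 𝓝 s, f r = g r) (hf : HasDerivAt f f' s) (hg : HasDerivAt g g' s) : f' = g' :=
  hf.unique (hg.congr_of_eventuallyEq h)

end Calculus

/-! ### Necessary conditions -/

section Necessary

variable {Ω : Set Jet0} {Φ : Jet0 → Jet0} {a b c : ℝ → ℝ} {A B C : ℝ}

/-- The transformed equation with denominators cleared, so that it can be compared coefficientwise
in the free coordinates `u_x` and `u_xx`. -/
theorem determining_identity (hΩ : IsOpen Ω) (h : IsPointTransformation Φ Ω)
    (hx : ∀ p ∈ Ω, pdx (compT Φ) p = 0) (hu : ∀ p ∈ Ω, pdu (compT Φ) p = 0)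
    (hE : MapsEquation Φ Ω (equation a b c) (equation (fun _ => A) (fun _ => B) (fun _ => C)))
    {j : Jet2} (hj : j.base ∈ Ω) (hT : pdt (compT Φ) j.base ≠ 0)
    (hX : totalX0 (compX Φ) j.toJet1 ≠ 0)
    (hut : j.ut = a j.t ^ 2 * j.uxx + b j.t * j.u - c j.t * j.u ^ 3) :
    totalX0 (compX Φ) j.toJet1 ^ 2 * (totalX0 (compX Φ) j.toJet1 * totalT0 (compU Φ) j.toJet1
        - totalT0 (compX Φ) j.toJet1 * totalX0 (compU Φ) j.toJet1)
      = A ^ 2 * pdt (compT Φ) j.base * (totalXX (compU Φ) j * totalX0 (compX Φ) j.toJet1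
        - totalX0 (compU Φ) j.toJet1 * totalXX (compX Φ) j)
      + (B * compU Φ j.base - C * compU Φ j.base ^ 3) * pdt (compT Φ) j.base
        * totalX0 (compX Φ) j.toJet1 ^ 3 := by
  have hx' : pdx (compT Φ) j.toJet1.1 = 0 := hx _ hj
  have hu' : pdu (compT Φ) j.toJet1.1 = 0 := hu _ hj
  have hJ : totalJac Φ j.toJet1 ≠ 0 := by
    rw [totalJac_of_pd_compT_eq_zero hx' hu']
    exact mul_ne_zero hT hX
  have key : prolong Φ j ∈ equation _ _ _ := (hE j hj hJ).1 hut
  have hb : j.toJet1.1 = j.base := rfl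
  simp only [equation, Set.mem_ofPred_eq, prolong] at key
  rw [newDx_newUx hΩ h hx hu hj hJ, newUt_of_pd_compT_eq_zero hx' hu', hb] at key
  field_simp at key
  linear_combination key

theorem sq_totalX0_compX (hΩ : IsOpen Ω) (h : IsPointTransformation Φ Ω)
    (hx : ∀ p ∈ Ω, pdx (compT Φ) p = 0) (hu : ∀ p ∈ Ω, pdu (compT Φ) p = 0)
    (hE : MapsEquation Φ Ω (equation a b c) (equation (fun _ => A) (fun _ => B) (fun _ => C)))
    {t x u : ℝ} (hp : ((t, x, u) : Jet0) ∈ Ω) (hdet : jacDet Φ (t, x, u) ≠ 0) (ux : ℝ)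
    (hX : pdx (compX Φ) (t, x, u) + ux * pdu (compX Φ) (t, x, u) ≠ 0) :
    a t ^ 2 * (pdx (compX Φ) (t, x, u) + ux * pdu (compX Φ) (t, x, u)) ^ 2
      = A ^ 2 * pdt (compT Φ) (t, x, u) := by
  rw [jacDet_of_pd_compT_eq_zero (hx _ hp) (hu _ hp)] at hdet
  have hT := left_ne_zero_of_mul hdet
  have hδ := right_ne_zero_of_mul hdet
  have key := fun w : ℝ => determining_identity hΩ h hx hu hE
    (j := ⟨t, x, u, a t ^ 2 * w + b t * u - c t * u ^ 3, ux, 0, 0, w⟩) hp hT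
    (by rw [totalX0_toJet1]; exact hX) rfl
  have k0 := key 0
  have k1 := key 1
  simp only [totalX0_toJet1, totalT0_toJet1, totalXX, Jet2.base] at k0 k1
  -- The coefficient of `u_xx` carries on both sides the factor `X_x U_u - X_u U_x`, nonzero by
  -- `hdet`.
  apply mul_right_cancel₀ hδ
  linear_combination k1 - k0

/-- If `X_u ≠ 0`, a suitable `u_x` gives `D_x X` the value `1` or `2`, while `a² (D_x X)²` stays
equal to `A² T_t`; then `a = 0`. -/
theorem pdu_compX_eq_zero (hΩ : IsOpen Ω) (h : IsPointTransformation Φ Ω)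
    (ha : ∀ p ∈ Ω, a p.1 ≠ 0)
    (hx : ∀ p ∈ Ω, pdx (compT Φ) p = 0) (hu : ∀ p ∈ Ω, pdu (compT Φ) p = 0)
    (hE : MapsEquation Φ Ω (equation a b c) (equation (fun _ => A) (fun _ => B) (fun _ => C)))
    {p : Jet0} (hp : p ∈ Ω) (hdet : jacDet Φ p ≠ 0) : pdu (compX Φ) p = 0 := by
  obtain ⟨t, x, u⟩ := p
  by_contra h0
  have key := sq_totalX0_compX hΩ h hx hu hE hp hdet
  have hat : a t ≠ 0 := ha _ hp
  set Xx := pdx (compX Φ) (t, x, u)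
  set Xu := pdu (compX Φ) (t, x, u)
  have e : ∀ r : ℝ, Xx + (r - Xx) / Xu * Xu = r := by
    intro r
    field_simp
    ring
  have k1 := key ((1 - Xx) / Xu) (by rw [e]; norm_num)
  have k2 := key ((2 - Xx) / Xu) (by rw [e]; norm_num)
  rw [e] at k1 k2
  have : a t ^ 2 = 0 := by linarith
  exact hat (pow_eq_zero_iff (two_ne_zero) |>.1 this)

theorem necessary_conditions (hΩ : IsOpen Ω) (h : IsPointTransformation Φ Ω)
    (hA : A ≠ 0) (hC : C ≠ 0) (ha : ∀ p ∈ Ω, a p.1 ≠ 0)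
    (hE : MapsEquation Φ Ω (equation a b c) (equation (fun _ => A) (fun _ => B) (fun _ => C)))
    {t x u : ℝ} (hp : ((t, x, u) : Jet0) ∈ Ω) :
    pdu (compU Φ) (t, x, u) ≠ 0 ∧ pdx (compX Φ) (t, x, u) ≠ 0 ∧
    a t ^ 2 * pdx (compX Φ) (t, x, u) ^ 2 = A ^ 2 * pdt (compT Φ) (t, x, u) ∧
    pdt (pdx (compX Φ)) (t, x, u) = 0 ∧
    c t = C * pdt (compT Φ) (t, x, u) * pdu (compU Φ) (t, x, u) ^ 2 ∧
    pdt (pdu (compU Φ)) (t, x, u) + b t * pdu (compU Φ) (t, x, u)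
      = B * pdu (compU Φ) (t, x, u) * pdt (compT Φ) (t, x, u) := by
  have hx : ∀ p ∈ Ω, pdx (compT Φ) p = 0 := fun p hp =>
    (pdx_compT_and_pdu_compT_eq_zero hΩ h hA ha hE hp).1
  have hu : ∀ p ∈ Ω, pdu (compT Φ) p = 0 := fun p hp =>
    (pdx_compT_and_pdu_compT_eq_zero hΩ h hA ha hE hp).2
  have hdet : ∀ p ∈ Ω, jacDet Φ p ≠ 0 := fun p hp =>
    (det_fderiv_ne_zero_iff ((h.smooth.contDiffAt (hΩ.mem_nhds hp)).differentiableAt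
      (by simp))).1 (h.det_ne_zero _ hp)
  have hXu : ∀ p ∈ Ω, pdu (compX Φ) p = 0 := fun p hp =>
    pdu_compX_eq_zero hΩ h ha hx hu hE hp (hdet p hp)
  have hsq := fun {t x u : ℝ} (hp : ((t, x, u) : Jet0) ∈ Ω) =>
    sq_totalX0_compX hΩ h hx hu hE hp (hdet _ hp) 0
  have sT := h.contDiffOn_compT
  have sX := h.contDiffOn_compX
  have sU := h.contDiffOn_compU
  have hdi := @determining_identity Ω Φ a b c A B C hΩ h hx hu hE
  simp only [totalX0_toJet1, totalT0_toJet1, totalXX] at hdi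
  simp only [zero_mul, add_zero] at hsq
  set T := compT Φ
  set X := compX Φ
  set U := compU Φ
  have hne : ∀ p ∈ Ω, pdt T p ≠ 0 ∧ pdx X p ≠ 0 ∧ pdu U p ≠ 0 := by
    intro p hp
    have := hdet p hp
    rw [jacDet_of_pd_compT_eq_zero (hx _ hp) (hu _ hp), hXu p hp, zero_mul, sub_zero] at this
    exact ⟨left_ne_zero_of_mul this, left_ne_zero_of_mul (right_ne_zero_of_mul this),
      right_ne_zero_of_mul (right_ne_zero_of_mul this)⟩
  have hsq' : ∀ t x u : ℝ, ((t, x, u) : Jet0) ∈ Ω → a t ^ 2 * pdx X (t, x, u) ^ 2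
      = A ^ 2 * pdt T (t, x, u) := fun t x u hp => hsq hp (hne _ hp).2.1
  have hTtx : ∀ p ∈ Ω, pdx (pdt T) p = 0 := by
    intro p hp
    rw [← pdt_pdx_comm hΩ sT hp, pdt, fderiv_eq_zero_of_eqOn hΩ hx hp]; rfl
  have hTtu : ∀ p ∈ Ω, pdu (pdt T) p = 0 := by
    intro p hp
    rw [← pdt_pdu_comm hΩ sT hp, pdt, fderiv_eq_zero_of_eqOn hΩ hu hp]; rfl
  have hXxu : ∀ p ∈ Ω, pdu (pdx X) p = 0 := by
    intro p hp
    rw [← pdx_pdu_comm hΩ sX hp, pdx, fderiv_eq_zero_of_eqOn hΩ hXu hp]; rfl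
  have hXtu : ∀ p ∈ Ω, pdu (pdt X) p = 0 := by
    intro p hp
    rw [← pdt_pdu_comm hΩ sX hp, pdt, fderiv_eq_zero_of_eqOn hΩ hXu hp]; rfl
  have hXuu : ∀ p ∈ Ω, pdu (pdu X) p = 0 := by
    intro p hp
    rw [pdu, fderiv_eq_zero_of_eqOn hΩ hXu hp]; rfl
  have hXxx : ∀ t x u : ℝ, ((t, x, u) : Jet0) ∈ Ω → pdx (pdx X) (t, x, u) = 0 := by
    intro t x u hp
    have hat : a t ≠ 0 := ha _ hp
    have e := eq_of_eventually_eq_of_hasDerivAt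
      ((eventually_mem_x hΩ hp).mono fun s hs => hsq' t s u hs)
      (((hasDerivAt_x hΩ (contDiffOn_pdx hΩ sX) hp).fun_pow 2).const_mul (a t ^ 2))
      ((hasDerivAt_x hΩ (contDiffOn_pdt hΩ sT) hp).const_mul (A ^ 2))
    rw [hTtx _ hp] at e
    simpa [hat, (hne _ hp).2.1] using e
  -- The determining identity at `u_xx = 0`, with `A² T_t` replaced by `a² X_x²` and the factor
  -- `X_x²` cancelled. It is quadratic in `r = u_x`; the values `r = 0, 1, -1` separate its
  -- coefficients.
  have hid : ∀ t x u : ℝ, ((t, x, u) : Jet0) ∈ Ω → ∀ r : ℝ,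
      pdx X (t, x, u) * (pdt U (t, x, u) + (b t * u - c t * u ^ 3) * pdu U (t, x, u))
        - pdt X (t, x, u) * (pdx U (t, x, u) + r * pdu U (t, x, u))
      = a t ^ 2 * (pdx (pdx U) (t, x, u) + 2 * r * pdu (pdx U) (t, x, u)
          + r ^ 2 * pdu (pdu U) (t, x, u)) * pdx X (t, x, u)
        + (B * U (t, x, u) - C * U (t, x, u) ^ 3) * pdt T (t, x, u) * pdx X (t, x, u) := by
    intro t x u hp r
    have key := @hdi
      ⟨t, x, u, a t ^ 2 * 0 + b t * u - c t * u ^ 3, r, 0, 0, 0⟩ hp (hne _ hp).1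
      (by simpa [Jet2.base, hXu _ hp] using (hne _ hp).2.1) rfl
    simp only [Jet2.base] at key
    rw [hXu _ hp, hXxu _ hp, hXuu _ hp, hXxx _ _ _ hp] at key
    apply mul_left_cancel₀ (pow_ne_zero 2 (hne _ hp).2.1)
    linear_combination key - pdx X (t, x, u) * (pdx (pdx U) (t, x, u)
      + 2 * r * pdu (pdx U) (t, x, u) + r ^ 2 * pdu (pdu U) (t, x, u)) * hsq' _ _ _ hp
  have hid0 : ∀ t x u : ℝ, ((t, x, u) : Jet0) ∈ Ω →
      pdx X (t, x, u) * (pdt U (t, x, u) + (b t * u - c t * u ^ 3) * pdu U (t, x, u))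
        - pdt X (t, x, u) * pdx U (t, x, u)
      = a t ^ 2 * pdx (pdx U) (t, x, u) * pdx X (t, x, u)
        + (B * U (t, x, u) - C * U (t, x, u) ^ 3) * pdt T (t, x, u) * pdx X (t, x, u) := by
    intro t x u hp
    linear_combination hid t x u hp 0
  have hUuu : ∀ p ∈ Ω, pdu (pdu U) p = 0 := by
    rintro ⟨t, x, u⟩ hp
    have hat : a t ≠ 0 := ha _ hp
    have e : a t ^ 2 * pdx X (t, x, u) * pdu (pdu U) (t, x, u) = 0 := by
      linear_combination hid t x u hp 0 - (hid t x u hp 1 + hid t x u hp (-1)) / 2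
    simpa [hat, (hne _ hp).2.1] using e
  have hXt : ∀ t x u : ℝ, ((t, x, u) : Jet0) ∈ Ω → -(pdt X (t, x, u) * pdu U (t, x, u))
      = 2 * a t ^ 2 * pdu (pdx U) (t, x, u) * pdx X (t, x, u) := by
    intro t x u hp
    linear_combination (hid t x u hp 1 - hid t x u hp (-1)) / 2
  have zfun : ∀ {F : Jet0 → ℝ}, (∀ p ∈ Ω, F p = 0) → ∀ p ∈ Ω, pdt F p = 0 ∧ pdx F p = 0
      ∧ pdu F p = 0 := by
    intro F hF p hp
    rw [pdt, pdx, pdu, fderiv_eq_zero_of_eqOn hΩ hF hp]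
    exact ⟨rfl, rfl, rfl⟩
  have sUu := contDiffOn_pdu hΩ sU
  have sUt := contDiffOn_pdt hΩ sU
  have sUx := contDiffOn_pdx hΩ sU
  have sUxx := contDiffOn_pdx hΩ sUx
  have hUut : ∀ p ∈ Ω, pdu (pdu (pdt U)) p = 0 := by
    intro p hp
    rw [pdu, fderiv_eq_of_eqOn hΩ (fun q hq => (pdt_pdu_comm hΩ sU hq).symm) hp]
    exact (pdt_pdu_comm hΩ sUu hp).symm.trans (zfun hUuu p hp).1
  have hUux : ∀ p ∈ Ω, pdu (pdu (pdx U)) p = 0 := by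
    intro p hp
    rw [pdu, fderiv_eq_of_eqOn hΩ (fun q hq => (pdx_pdu_comm hΩ sU hq).symm) hp]
    exact (pdx_pdu_comm hΩ sUu hp).symm.trans (zfun hUuu p hp).2.1
  have hUuxx : ∀ p ∈ Ω, pdu (pdu (pdx (pdx U))) p = 0 := by
    intro p hp
    rw [pdu, fderiv_eq_of_eqOn hΩ (fun q hq => (pdx_pdu_comm hΩ sUx hq).symm) hp]
    exact (pdx_pdu_comm hΩ (contDiffOn_pdu hΩ sUx) hp).symm.trans (zfun hUux p hp).2.1
  -- Next, three successive `u`-derivatives of the part free of `u_x`. Because `U_uu = 0` and `T_t,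
  -- X_x, X_t` do not depend on `u`, only the cubic terms survive two of them.
  have hid1 : ∀ t x u : ℝ, ((t, x, u) : Jet0) ∈ Ω →
      pdx X (t, x, u) * (pdu (pdt U) (t, x, u) + (b t - 3 * c t * u ^ 2) * pdu U (t, x, u))
        - pdt X (t, x, u) * pdu (pdx U) (t, x, u)
      = a t ^ 2 * pdu (pdx (pdx U)) (t, x, u) * pdx X (t, x, u)
        + (B * pdu U (t, x, u) - 3 * C * U (t, x, u) ^ 2 * pdu U (t, x, u))
          * pdt T (t, x, u) * pdx X (t, x, u) := by
    intro t x u hp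
    have dXx := hasDerivAt_u hΩ (contDiffOn_pdx hΩ sX) hp
    have dXt := hasDerivAt_u hΩ (contDiffOn_pdt hΩ sX) hp
    have dTt := hasDerivAt_u hΩ (contDiffOn_pdt hΩ sT) hp
    have dU := hasDerivAt_u hΩ sU hp
    have dUu := hasDerivAt_u hΩ sUu hp
    have dUt := hasDerivAt_u hΩ sUt hp
    have dUx := hasDerivAt_u hΩ sUx hp
    have dUxx := hasDerivAt_u hΩ sUxx hp
    have di := hasDerivAt_id' u
    have e := eq_of_eventually_eq_of_hasDerivAt
      ((eventually_mem_u hΩ hp).mono fun s hs => hid0 t x s hs)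
      ((dXx.fun_mul (dUt.fun_add (((di.const_mul (b t)).fun_sub
        ((di.fun_pow 3).const_mul (c t))).fun_mul dUu))).fun_sub (dXt.fun_mul dUx))
      (((dUxx.const_mul (a t ^ 2)).fun_mul dXx).fun_add
        ((((dU.const_mul B).fun_sub ((dU.fun_pow 3).const_mul C)).fun_mul dTt).fun_mul dXx))
    rw [hXxu _ hp, hXtu _ hp, hTtu _ hp, hUuu _ hp] at e
    push_cast at e
    linear_combination e
  have hid2 : ∀ t x u : ℝ, ((t, x, u) : Jet0) ∈ Ω →
      c t * u = C * pdt T (t, x, u) * U (t, x, u) * pdu U (t, x, u) := by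
    intro t x u hp
    have dXx := hasDerivAt_u hΩ (contDiffOn_pdx hΩ sX) hp
    have dXt := hasDerivAt_u hΩ (contDiffOn_pdt hΩ sX) hp
    have dTt := hasDerivAt_u hΩ (contDiffOn_pdt hΩ sT) hp
    have dU := hasDerivAt_u hΩ sU hp
    have dUu := hasDerivAt_u hΩ sUu hp
    have dUt := hasDerivAt_u hΩ (contDiffOn_pdu hΩ sUt) hp
    have dUx := hasDerivAt_u hΩ (contDiffOn_pdu hΩ sUx) hp
    have dUxx := hasDerivAt_u hΩ (contDiffOn_pdu hΩ sUxx) hp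
    have di := hasDerivAt_id' u
    have e := eq_of_eventually_eq_of_hasDerivAt
      ((eventually_mem_u hΩ hp).mono fun s hs => hid1 t x s hs)
      ((dXx.fun_mul (dUt.fun_add (((hasDerivAt_const u (b t)).fun_sub
        ((di.fun_pow 2).const_mul (3 * c t))).fun_mul dUu))).fun_sub (dXt.fun_mul dUx))
      (((dUxx.const_mul (a t ^ 2)).fun_mul dXx).fun_add
        ((((dUu.const_mul B).fun_sub
          (((dU.fun_pow 2).const_mul (3 * C)).fun_mul dUu)).fun_mul dTt).fun_mul dXx))
    rw [hXxu _ hp, hXtu _ hp, hTtu _ hp, hUuu _ hp, hUut _ hp, hUux _ hp, hUuxx _ hp] at e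
    push_cast at e
    apply mul_left_cancel₀ (mul_ne_zero (hne _ hp).2.1 (hne _ hp).2.2)
    linear_combination (-1 / 6) * e
  have hid3 : ∀ t x u : ℝ, ((t, x, u) : Jet0) ∈ Ω →
      c t = C * pdt T (t, x, u) * pdu U (t, x, u) ^ 2 := by
    intro t x u hp
    have e := eq_of_eventually_eq_of_hasDerivAt
      ((eventually_mem_u hΩ hp).mono fun s hs => hid2 t x s hs)
      ((hasDerivAt_id' u).const_mul (c t))
      ((((hasDerivAt_u hΩ (contDiffOn_pdt hΩ sT) hp).const_mul C).fun_mul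
        (hasDerivAt_u hΩ sU hp)).fun_mul (hasDerivAt_u hΩ sUu hp))
    rw [hTtu _ hp, hUuu _ hp] at e
    linear_combination e
  -- In `c = C T_t U_u²` neither `c` nor `T_t` depends on `x`, so neither does `U_u`.
  have hUxu : ∀ p ∈ Ω, pdx (pdu U) p = 0 := by
    rintro ⟨t, x, u⟩ hp
    have e := eq_of_eventually_eq_of_hasDerivAt
      ((eventually_mem_x hΩ hp).mono fun s hs => hid3 t s u hs)
      (hasDerivAt_const x (c t))
      (((hasDerivAt_x hΩ (contDiffOn_pdt hΩ sT) hp).const_mul C).fun_mul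
        ((hasDerivAt_x hΩ sUu hp).fun_pow 2))
    rw [hTtx _ hp] at e
    simpa [hC, (hne _ hp).1, (hne _ hp).2.2] using e
  have hUux0 : ∀ p ∈ Ω, pdu (pdx U) p = 0 := fun p hp => by
    rw [← pdx_pdu_comm hΩ sU hp, hUxu p hp]
  have hXt0 : ∀ p ∈ Ω, pdt X p = 0 := by
    rintro ⟨t, x, u⟩ hp
    have e := hXt t x u hp
    rw [hUux0 _ hp] at e
    simpa [(hne _ hp).2.2] using e
  refine ⟨(hne _ hp).2.2, (hne _ hp).2.1, hsq' _ _ _ hp, ?_, hid3 _ _ _ hp, ?_⟩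
  · rw [pdt_pdx_comm hΩ sX hp]
    exact (zfun hXt0 _ hp).2.1
  · have e := hid1 t x u hp
    have hR : pdu (pdx (pdx U)) (t, x, u) = 0 := by
      rw [← pdx_pdu_comm hΩ sUx hp]
      exact (zfun hUux0 _ hp).2.1
    -- Comparing the second and third `u`-derivatives excludes an additive term in `U`; the cubic
    -- terms of `hid1` then cancel.
    have hlin : U (t, x, u) = u * pdu U (t, x, u) := by
      apply mul_left_cancel₀ (mul_ne_zero (mul_ne_zero hC (hne _ hp).1) (hne _ hp).2.2)
      linear_combination u * hid3 t x u hp - hid2 t x u hp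
    rw [hR, hUux0 _ hp, hlin, hid3 t x u hp, ← pdt_pdu_comm hΩ sU hp] at e
    apply mul_left_cancel₀ (hne _ hp).2.1
    linear_combination e

end Necessary


theorem exists_const_of_reducible {I : Set ℝ} (hIo : IsOpen I) (hIc : IsConnected I)
    {a b c : ℝ → ℝ} (ha0 : ∀ t ∈ I, a t ≠ 0)
    {Ω : Set Jet0} (hΩ : IsOpen Ω) (hΩI : Prod.fst '' Ω = I)
    (hred : ReducibleToConstant a b c Ω) :
    ∃ lam : ℝ, ∀ t ∈ I,
      b t / a t ^ 2 + 1 / 2 * (deriv (fun s => c s / a s ^ 2) t / c t) = lam := by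
  obtain ⟨Φ, A, B, C, hA, hC, h, hE⟩ := hred
  have ha : ∀ p ∈ Ω, a p.1 ≠ 0 := fun p hp => ha0 _ (hΩI ▸ Set.mem_image_of_mem _ hp)
  have hN := fun {t x u : ℝ} (hp : ((t, x, u) : Jet0) ∈ Ω) =>
    necessary_conditions hΩ h hA hC ha hE hp
  have sXx := contDiffOn_pdx hΩ h.contDiffOn_compX
  have sUu := contDiffOn_pdu hΩ h.contDiffOn_compU
  have hval : ∀ t x u : ℝ, ((t, x, u) : Jet0) ∈ Ω →
      b t / a t ^ 2 + 1 / 2 * (deriv (fun s => c s / a s ^ 2) t / c t)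
        = B / A ^ 2 * pdx (compX Φ) (t, x, u) ^ 2 := by
    intro t x u hp
    have hev : (fun s => c s / a s ^ 2) =ᶠ[𝓝 t] fun s =>
        C / A ^ 2 * (pdx (compX Φ) (s, x, u) ^ 2 * pdu (compU Φ) (s, x, u) ^ 2) := by
      filter_upwards [eventually_mem_t hΩ hp] with s hs
      obtain ⟨-, -, h3, -, h5, -⟩ := hN hs
      have has : a s ≠ 0 := ha _ hs
      rw [h5]
      field_simp
      linear_combination -pdu (compU Φ) (s, x, u) ^ 2 * h3
    have hd := ((((hasDerivAt_t hΩ sXx hp).fun_pow 2).fun_mul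
      ((hasDerivAt_t hΩ sUu hp).fun_pow 2)).const_mul (C / A ^ 2)).deriv
    obtain ⟨h1, h2, h3, h4, h5, h6⟩ := hN hp
    have hat : a t ≠ 0 := ha _ hp
    have hTt : pdt (compT Φ) (t, x, u) = a t ^ 2 * pdx (compX Φ) (t, x, u) ^ 2 / A ^ 2 := by
      rw [h3]; field_simp
    rw [hev.deriv_eq, hd, h4, h5, hTt]
    rw [hTt] at h6
    push_cast
    field_simp at h6 ⊢
    linear_combination pdx (compX Φ) (t, x, u) * h6
  -- Above each `t` some point `(t, x, u)` of `Ω` is chosen. By openness `hval` holds with the same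
  -- `x, u` at nearby times, where `X_xt = 0` applies, so connectedness is needed of `I` only.
  have hderiv : ∀ t ∈ I, HasDerivAt (fun t =>
      b t / a t ^ 2 + 1 / 2 * (deriv (fun s => c s / a s ^ 2) t / c t)) 0 t := by
    intro t ht
    rw [← hΩI] at ht
    obtain ⟨⟨t, x, u⟩, hp, rfl⟩ := ht
    have hd := ((hasDerivAt_t hΩ sXx hp).fun_pow 2).const_mul (B / A ^ 2)
    rw [(hN hp).2.2.2.1] at hd
    simp only [mul_zero] at hd
    exact hd.congr_of_eventuallyEq ((eventually_mem_t hΩ hp).mono fun s hs => hval s x u hs)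
  exact hIo.exists_is_const_of_deriv_eq_zero hIc.isPreconnected
    (fun t ht => (hderiv t ht).differentiableAt.differentiableWithinAt)
    (fun t ht => (hderiv t ht).deriv)

/-! ### Sufficiency -/

theorem exists_sign_of_ne_zero {I : Set ℝ} (hIc : IsConnected I) {c : ℝ → ℝ}
    (hc : ContinuousOn c I) (hc0 : ∀ t ∈ I, c t ≠ 0) :
    ∃ σ : ℝ, σ ^ 2 = 1 ∧ ∀ t ∈ I, 0 < σ * c t := by
  obtain ⟨t₀, ht₀⟩ := hIc.nonempty
  rcases lt_or_gt_of_ne (hc0 t₀ ht₀) with h | h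
  · refine ⟨-1, by norm_num, fun t ht => ?_⟩
    by_contra hn
    obtain ⟨s, hs, h0⟩ := hIc.isPreconnected.intermediate_value ht₀ ht hc
      (show (0 : ℝ) ∈ Set.Icc (c t₀) (c t) from ⟨h.le, by linarith⟩)
    exact hc0 s hs h0
  · refine ⟨1, by norm_num, fun t ht => ?_⟩
    by_contra hn
    obtain ⟨s, hs, h0⟩ := hIc.isPreconnected.intermediate_value ht ht₀ hc
      (show (0 : ℝ) ∈ Set.Icc (c t) (c t₀) from ⟨by linarith, h.le⟩)
    exact hc0 s hs h0

theorem exists_smooth_antiderivative {I : Set ℝ} (hIo : IsOpen I) (hIc : IsConnected I)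
    {f : ℝ → ℝ} (hf : ContDiffOn ℝ ∞ f I) :
    ∃ τ : ℝ → ℝ, ContDiffOn ℝ ∞ τ I ∧ ∀ t ∈ I, HasDerivAt τ (f t) t := by
  obtain ⟨t₀, ht₀⟩ := hIc.nonempty
  have hd : ∀ t ∈ I, HasDerivAt (fun r => ∫ s in t₀..r, f s) (f t) t := by
    intro t ht
    have hsub : Set.uIcc t₀ t ⊆ I := hIc.isPreconnected.ordConnected.uIcc_subset ht₀ ht
    exact intervalIntegral.integral_hasDerivAt_right
      ((hf.continuousOn.mono hsub).intervalIntegrable)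
      (hf.continuousOn.stronglyMeasurableAtFilter hIo t ht)
      (hf.continuousOn.continuousAt (hIo.mem_nhds ht))
  refine ⟨_, (contDiffOn_infty_iff_deriv_of_isOpen hIo).2
    ⟨fun t ht => (hd t ht).differentiableAt.differentiableWithinAt,
      hf.congr fun t ht => (hd t ht).deriv⟩, hd⟩

theorem injOn_of_hasDerivAt_pos {I : Set ℝ} (hIo : IsOpen I) (hIc : IsConnected I)
    {τ f : ℝ → ℝ} (hτ : ∀ t ∈ I, HasDerivAt τ (f t) t) (hf : ∀ t ∈ I, 0 < f t) :
    Set.InjOn τ I := by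
  refine (strictMonoOn_of_deriv_pos hIc.isPreconnected.convex
    (fun t ht => (hτ t ht).continuousAt.continuousWithinAt) ?_).injOn
  intro t ht
  rw [hIo.interior_eq] at ht
  rw [(hτ t ht).deriv]
  exact hf t ht

/-- The transformation `t' = τ(t)`, `x' = x`, `u' = ψ(t) u`. -/
def scaling (τ ψ : ℝ → ℝ) (p : Jet0) : Jet0 := (τ p.1, p.2.1, ψ p.1 * p.2.2)

/-! ### Change of time combined with rescaling of `u` -/

section Scaling

variable {I : Set ℝ} {Ω : Set Jet0} {τ ψ : ℝ → ℝ}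

theorem contDiffOn_scaling (hΩI : Prod.fst '' Ω = I) (hτ : ContDiffOn ℝ ∞ τ I)
    (hψ : ContDiffOn ℝ ∞ ψ I) : ContDiffOn ℝ ∞ (scaling τ ψ) Ω := by
  have hmaps : Set.MapsTo Prod.fst Ω I := fun p hp => hΩI ▸ Set.mem_image_of_mem _ hp
  have h1 : ContDiffOn ℝ ∞ (fun p : Jet0 => τ p.1) Ω := hτ.comp contDiffOn_fst hmaps
  have h2 : ContDiffOn ℝ ∞ (fun p : Jet0 => ψ p.1) Ω := hψ.comp contDiffOn_fst hmaps
  have h3 : ContDiffOn ℝ ∞ (fun p : Jet0 => p.2.1) Ω := contDiffOn_snd.fst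
  have h4 : ContDiffOn ℝ ∞ (fun p : Jet0 => p.2.2) Ω := contDiffOn_snd.snd
  exact h1.prodMk (h3.prodMk (h2.mul h4))

theorem pd_scaling (hΩ : IsOpen Ω) (hs : ContDiffOn ℝ ∞ (scaling τ ψ) Ω) {τ' ψ' t x u : ℝ}
    (hp : ((t, x, u) : Jet0) ∈ Ω) (hτ : HasDerivAt τ τ' t) (hψ : HasDerivAt ψ ψ' t) :
    (pdt (compT (scaling τ ψ)) (t, x, u) = τ' ∧ pdx (compT (scaling τ ψ)) (t, x, u) = 0 ∧
      pdu (compT (scaling τ ψ)) (t, x, u) = 0) ∧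
    (pdt (compX (scaling τ ψ)) (t, x, u) = 0 ∧ pdx (compX (scaling τ ψ)) (t, x, u) = 1 ∧
      pdu (compX (scaling τ ψ)) (t, x, u) = 0) ∧
    (pdt (compU (scaling τ ψ)) (t, x, u) = ψ' * u ∧ pdx (compU (scaling τ ψ)) (t, x, u) = 0 ∧
      pdu (compU (scaling τ ψ)) (t, x, u) = ψ t) := by
  have sT : ContDiffOn ℝ ∞ (compT (scaling τ ψ)) Ω := hs.fst
  have sX : ContDiffOn ℝ ∞ (compX (scaling τ ψ)) Ω := hs.snd.fst
  have sU : ContDiffOn ℝ ∞ (compU (scaling τ ψ)) Ω := hs.snd.snd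
  refine ⟨⟨?_, ?_, ?_⟩, ⟨?_, ?_, ?_⟩, ⟨?_, ?_, ?_⟩⟩
  · exact (hasDerivAt_t hΩ sT hp).unique hτ
  · exact (hasDerivAt_x hΩ sT hp).unique (hasDerivAt_const x (τ t))
  · exact (hasDerivAt_u hΩ sT hp).unique (hasDerivAt_const u (τ t))
  · exact (hasDerivAt_t hΩ sX hp).unique (hasDerivAt_const t x)
  · exact (hasDerivAt_x hΩ sX hp).unique (hasDerivAt_id x)
  · exact (hasDerivAt_u hΩ sX hp).unique (hasDerivAt_const u x)
  · exact (hasDerivAt_t hΩ sU hp).unique (hψ.mul_const u)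
  · exact (hasDerivAt_x hΩ sU hp).unique (hasDerivAt_const x (ψ t * u))
  · exact (hasDerivAt_u hΩ sU hp).unique (by
      have h := (hasDerivAt_id' u).const_mul (ψ t)
      rw [mul_one] at h
      exact h)

theorem isPointTransformation_scaling (hΩ : IsOpen Ω) (hΩI : Prod.fst '' Ω = I)
    {τ' ψ' : ℝ → ℝ} (hτs : ContDiffOn ℝ ∞ τ I) (hψs : ContDiffOn ℝ ∞ ψ I)
    (hτ : ∀ t ∈ I, HasDerivAt τ (τ' t) t) (hψ : ∀ t ∈ I, HasDerivAt ψ (ψ' t) t)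
    (hinj : Set.InjOn τ I) (hτ0 : ∀ t ∈ I, τ' t ≠ 0) (hψ0 : ∀ t ∈ I, ψ t ≠ 0) :
    IsPointTransformation (scaling τ ψ) Ω := by
  have hs := contDiffOn_scaling hΩI hτs hψs
  have hmem : ∀ p ∈ Ω, p.1 ∈ I := fun p hp => hΩI ▸ Set.mem_image_of_mem _ hp
  refine ⟨hs, ?_, ?_⟩
  · rintro ⟨t, x, u⟩ hp ⟨t', x', u'⟩ hp' he
    simp only [scaling, Prod.mk.injEq] at he
    obtain ⟨e1, e2, e3⟩ := he
    obtain rfl : t = t' := hinj (hmem _ hp) (hmem _ hp') e1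
    have := mul_left_cancel₀ (hψ0 t (hmem _ hp)) e3
    simp [e2, this]
  · rintro ⟨t, x, u⟩ hp
    have ht : t ∈ I := hmem _ hp
    rw [det_fderiv_ne_zero_iff
      ((hs.contDiffAt (hΩ.mem_nhds hp)).differentiableAt (by simp))]
    obtain ⟨⟨h1, h2, h3⟩, ⟨h4, h5, h6⟩, ⟨h7, h8, h9⟩⟩ := pd_scaling hΩ hs hp (hτ t ht) (hψ t ht)
    rw [jacDet_of_pd_compT_eq_zero h2 h3, h1, h5, h6, h9]
    simpa using ⟨hτ0 t ht, hψ0 t ht⟩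

/-- Here `u'_{t'} = (ψ' u + ψ u_t) / a²` and `u'_{x'x'} = ψ u_xx`. The conditions `hB` and `hC`
match the linear and cubic terms, and dividing by `ψ ≠ 0` gives the converse implication. -/
theorem mapsEquation_scaling {a b c : ℝ → ℝ} {B C : ℝ} (hΩ : IsOpen Ω)
    (hΩI : Prod.fst '' Ω = I) {ψ' : ℝ → ℝ} (h : IsPointTransformation (scaling τ ψ) Ω)
    (hτ : ∀ t ∈ I, HasDerivAt τ (a t ^ 2) t) (hψ : ∀ t ∈ I, HasDerivAt ψ (ψ' t) t)
    (ha0 : ∀ t ∈ I, a t ≠ 0) (hψ0 : ∀ t ∈ I, ψ t ≠ 0)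
    (hB : ∀ t ∈ I, ψ' t = ψ t * (a t ^ 2 * B - b t))
    (hC : ∀ t ∈ I, C * ψ t ^ 2 * a t ^ 2 = c t) :
    MapsEquation (scaling τ ψ) Ω (equation a b c)
      (equation (fun _ => 1) (fun _ => B) (fun _ => C)) := by
  have hmem : ∀ p ∈ Ω, p.1 ∈ I := fun p hp => hΩI ▸ Set.mem_image_of_mem _ hp
  have hpd := fun {t x u : ℝ} (hp : ((t, x, u) : Jet0) ∈ Ω) =>
    pd_scaling hΩ h.smooth hp (hτ t (hmem _ hp)) (hψ t (hmem _ hp))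
  rintro ⟨t, x, u, ut, ux, utt, utx, uxx⟩ hj hJ
  have hp : ((t, x, u) : Jet0) ∈ Ω := hj
  have ht : t ∈ I := hmem _ hp
  have hψt := hψ0 t ht
  have hat := ha0 t ht
  have sX := h.contDiffOn_compX
  have sU := h.contDiffOn_compU
  obtain ⟨⟨h1, h2, h3⟩, ⟨h4, h5, h6⟩, ⟨h7, h8, h9⟩⟩ := hpd hp
  have hXuz : ∀ p ∈ Ω, pdu (compX (scaling τ ψ)) p = 0 := fun ⟨_, _, _⟩ hp => (hpd hp).2.1.2.2
  have hUxz : ∀ p ∈ Ω, pdx (compU (scaling τ ψ)) p = 0 := fun ⟨_, _, _⟩ hp => (hpd hp).2.2.2.1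
  have hXuu : pdu (pdu (compX (scaling τ ψ))) (t, x, u) = 0 := by
    rw [pdu, fderiv_eq_zero_of_eqOn hΩ hXuz hp]; rfl
  have hXxu : pdu (pdx (compX (scaling τ ψ))) (t, x, u) = 0 := by
    rw [← pdx_pdu_comm hΩ sX hp, pdx, fderiv_eq_zero_of_eqOn hΩ hXuz hp]; rfl
  have hXxx : pdx (pdx (compX (scaling τ ψ))) (t, x, u) = 0 :=
    eq_of_eventually_eq_of_hasDerivAt
      ((eventually_mem_x hΩ hp).mono fun s hs => (hpd hs).2.1.2.1)
      (hasDerivAt_x hΩ (contDiffOn_pdx hΩ sX) hp) (hasDerivAt_const x 1)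
  have hUxx : pdx (pdx (compU (scaling τ ψ))) (t, x, u) = 0 := by
    rw [pdx, fderiv_eq_zero_of_eqOn hΩ hUxz hp]; rfl
  have hUxu : pdu (pdx (compU (scaling τ ψ))) (t, x, u) = 0 := by
    rw [pdu, fderiv_eq_zero_of_eqOn hΩ hUxz hp]; rfl
  have hUuu : pdu (pdu (compU (scaling τ ψ))) (t, x, u) = 0 :=
    eq_of_eventually_eq_of_hasDerivAt
      ((eventually_mem_u hΩ hp).mono fun s hs => (hpd hs).2.2.2.2)
      (hasDerivAt_u hΩ (contDiffOn_pdu hΩ sU) hp) (hasDerivAt_const u (ψ t))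
  simp only [equation, Set.mem_ofPred_eq, prolong]
  rw [newDx_newUx hΩ h (fun ⟨_, _, _⟩ hp => (hpd hp).1.2.1) (fun ⟨_, _, _⟩ hp => (hpd hp).1.2.2)
    hj hJ, newUt_of_pd_compT_eq_zero h2 h3]
  simp only [totalX0_toJet1, totalT0_toJet1, totalXX]
  simp only [Jet2.base, Jet2.toJet1, h1, h4, h5, h6,
    h7, h8, h9, hXuu, hXxu, hXxx, hUxx, hUxu, hUuu, compU, scaling, hB t ht, ← hC t ht]
  constructor
  · intro e
    rw [e]
    field_simp
    ring
  · intro e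
    field_simp at e
    apply mul_left_cancel₀ hψt
    linear_combination e

end Scaling

theorem reducible_of_const {I : Set ℝ} (hIo : IsOpen I) (hIc : IsConnected I)
    {a b c : ℝ → ℝ} (ha : ContDiffOn ℝ ∞ a I) (hc : ContDiffOn ℝ ∞ c I)
    (ha0 : ∀ t ∈ I, a t ≠ 0) (hc0 : ∀ t ∈ I, c t ≠ 0)
    {Ω : Set Jet0} (hΩ : IsOpen Ω) (hΩI : Prod.fst '' Ω = I) {lam : ℝ}
    (hlam : ∀ t ∈ I,
      b t / a t ^ 2 + 1 / 2 * (deriv (fun s => c s / a s ^ 2) t / c t) = lam) :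
    ReducibleToConstant a b c Ω := by
  obtain ⟨σ, hσ, hσc⟩ := exists_sign_of_ne_zero hIc hc.continuousOn hc0
  obtain ⟨τ, hτs, hτ⟩ := exists_smooth_antiderivative hIo hIc (ha.pow 2)
  have hg : ContDiffOn ℝ ∞ (fun s => c s / a s ^ 2) I :=
    hc.div (ha.pow 2) fun t ht => pow_ne_zero 2 (ha0 t ht)
  have hpos : ∀ t ∈ I, 0 < σ * (c t / a t ^ 2) := fun t ht => by
    have := hσc t ht
    have := ha0 t ht
    rw [← mul_div_assoc]
    positivity
  -- The condition `C ψ² a² = c` with `C = σ = ±1` forces this `ψ` up to sign.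
  set ψ : ℝ → ℝ := fun t => √(σ * (c t / a t ^ 2)) with hψdef
  have hψpos : ∀ t ∈ I, 0 < ψ t := fun t ht => Real.sqrt_pos.2 (hpos t ht)
  have hψsq : ∀ t ∈ I, ψ t ^ 2 = σ * (c t / a t ^ 2) := fun t ht => Real.sq_sqrt (hpos t ht).le
  have hψs : ContDiffOn ℝ ∞ ψ I :=
    (contDiffOn_const.mul hg).sqrt fun t ht => (hpos t ht).ne'
  have hψ : ∀ t ∈ I, HasDerivAt ψ (deriv ψ t) t := fun t ht =>
    ((hψs.contDiffAt (hIo.mem_nhds ht)).differentiableAt (by simp)).hasDerivAt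
  have hpt := isPointTransformation_scaling hΩ hΩI hτs hψs hτ hψ
    (injOn_of_hasDerivAt_pos hIo hIc hτ fun t ht => by
      have := ha0 t ht
      positivity)
    (fun t ht => pow_ne_zero 2 (ha0 t ht)) (fun t ht => (hψpos t ht).ne')
  refine ⟨scaling τ ψ, 1, lam, σ, one_ne_zero, ?_, hpt,
    mapsEquation_scaling hΩ hΩI hpt hτ hψ ha0 (fun t ht => (hψpos t ht).ne') ?_ ?_⟩
  · rintro rfl
    norm_num at hσ
  · intro t ht
    have hat := ha0 t ht
    have hct := hc0 t ht
    have hψt := (hψpos t ht).ne'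
    -- The required `ψ' = ψ (a² λ - b)` is the criterion itself: differentiating `ψ² = σ c / a²`
    -- gives `ψ' / ψ`, and `hl` solves the criterion for `a² λ - b`.
    have e : 2 * ψ t * deriv ψ t = σ * deriv (fun s => c s / a s ^ 2) t := by
      have := eq_of_eventually_eq_of_hasDerivAt
        (Filter.eventually_of_mem (hIo.mem_nhds ht) hψsq) ((hψ t ht).fun_pow 2)
        (((hg.contDiffAt (hIo.mem_nhds ht)).differentiableAt (by simp)).hasDerivAt.const_mul σ)
      rw [← this]
      push_cast
      ring
    have hl : a t ^ 2 * lam - b t = a t ^ 2 * deriv (fun s => c s / a s ^ 2) t / (2 * c t) := by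
      rw [← hlam t ht]
      field_simp
      ring
    have hs : ψ t ^ 2 * a t ^ 2 = σ * c t := by
      rw [hψsq t ht]
      field_simp
    rw [hl]
    field_simp
    apply mul_left_cancel₀ hψt
    linear_combination c t * e - deriv (fun s => c s / a s ^ 2) t * hs
  · intro t ht
    have hat := ha0 t ht
    rw [hψsq t ht]
    field_simp
    linear_combination c t * hσ

end NWS

theorem theorem2 (I : Set ℝ) (hIo : IsOpen I) (hIc : IsConnected I)
    (a b c : ℝ → ℝ)
    (ha : ContDiffOn ℝ ∞ a I) (hb : ContDiffOn ℝ ∞ b I) (hc : ContDiffOn ℝ ∞ c I)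
    (ha0 : ∀ t ∈ I, a t ≠ 0) (hc0 : ∀ t ∈ I, c t ≠ 0)
    (Ω : Set (ℝ × ℝ × ℝ)) (hΩo : IsOpen Ω) (hΩI : Prod.fst '' Ω = I) :
    NWS.ReducibleToConstant a b c Ω ↔
      ∃ lam : ℝ, ∀ t ∈ I,
        b t / a t ^ 2 + 1 / 2 * (deriv (fun s => c s / a s ^ 2) t / c t) = lam :=
  ⟨NWS.exists_const_of_reducible hIo hIc ha0 hΩo hΩI,
    fun ⟨_, hlam⟩ => NWS.reducible_of_const hIo hIc ha hc ha0 hc0 hΩo hΩI hlam⟩
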